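/- Let $0\le r\le s$ and $J\ge 0$ be integers. Let $p_1,\dots,p_J$ be noncommutative $*$-polynomials with complex coefficients in $x_1,\dots,x_s$ (that is, finite complex linear combinations of words in the letters $x_1,x_1^*,\dots,x_s,x_s^*$). Suppose that for each $j$ there is an integer $d_j\ge 1$ such that $p_j$ is $d_j$-homogeneous in $\{x_1,\dots,x_r\}$: in every monomial of $p_j$ the letters $x_k,x_k^*$ with $k\le r$ appear collectively exactly $d_j$ times (the letters with $k>r$ are unrestricted). Let $C_1,\dots,C_J>0$ and $0<q\le 2$ be real numbers. Then the universal (not necessarily unital) $C^*$-algebra $$A=C^*\Bigl\langle x_1,\dots,x_s \;\Big|\; \Bigl\|\sum_{k=1}^{s}(x_kx_k^*)^{q/2}\Bigr\|\le 1,\quad \|p_j(x_1,\dots,x_s)\|\le C_j\ \ (j=1,\dots,J)\Bigr\rangle$$ is projective: for every surjective $*$-homomorphism $\rho:B\to D$ of $C^*$-algebras and every $*$-homomorphism $\varphi:A\to D$ there is a $*$-homomorphism $\psi:A\to B$ with $\rho\circ\psi=\varphi$. -/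

import Mathlib

open scoped ENNReal

universe u v w

/-- A (not necessarily unital) C*-algebra `P` is projective (tested on C*-algebras in universe `w`)
if for every surjective *-homomorphism `ρ : B → C` the map `Hom(P, B) → Hom(P, C)`, `ψ ↦ ρ ∘ ψ`,
is onto. -/
def IsProjectiveCStar (P : Type v) [NonUnitalCStarAlgebra P] : Prop :=
  ∀ (B C : Type w) [NonUnitalCStarAlgebra B] [NonUnitalCStarAlgebra C]
    (ρ : B →⋆ₙₐ[ℂ] C), Function.Surjective ρ →
    Function.Surjective (fun ψ : P →⋆ₙₐ[ℂ] B => ρ.comp ψ)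

section Polynomials

/-- NC *-polynomials without constant term in `x_1, …, x_s`: formal complex linear combinations of
nonempty words in the `2 s` letters `x_k` (the letter `Sum.inl k`) and `x_k^*` (the letter
`Sum.inr k`). A polynomial that is homogeneous of degree at least one in some of the variables has
no constant term, so nothing is lost for those. -/
abbrev NCStarPoly (s : ℕ) : Type :=
  MonoidAlgebra ℂ (FreeSemigroup (Fin s ⊕ Fin s))

/-- The value of `p` at a tuple of elements of a C*-algebra: the value of a word is the product of
its letters, with `Sum.inl k` read as `x k` and `Sum.inr k` as `(x k)^*`. -/
noncomputable def NCStarPoly.eval {s : ℕ} (p : NCStarPoly s) {A : Type v}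
    [NonUnitalCStarAlgebra A] (x : Fin s → A) : A :=
  MonoidAlgebra.liftMagma ℂ
    (FreeSemigroup.lift (Sum.elim x (fun k => star (x k)))) p

/-- The number of letters `x_k` or `x_k^*` with `k` among the first `r` indices in a word. -/
def wordDegree {s : ℕ} (r : ℕ) (m : FreeSemigroup (Fin s ⊕ Fin s)) : ℕ :=
  (m.head :: m.tail).countP (fun l => decide ((Sum.elim id id l : Fin s).val < r))

/-- `p` is `d`-homogeneous in the first `r` variables: in each monomial of `p`
the `x_k` and `x_k^*` with `k` among the first `r` indices appear collectively `d` times. -/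
def NCStarPoly.IsHomogeneousInFirst {s : ℕ} (p : NCStarPoly s) (r d : ℕ) : Prop :=
  ∀ m ∈ p.coeff.support, wordDegree r m = d

end Polynomials

section Universal

/-- A set of relations on `s`-tuples of elements of C*-algebras. -/
abbrev CStarRelation (s : ℕ) : Type (u + 1) :=
  ∀ (A : Type u) [NonUnitalCStarAlgebra A], (Fin s → A) → Prop

/-- A representation of the relation `R`: a tuple in some C*-algebra that satisfies `R`. -/
structure CStarRep {s : ℕ} (R : CStarRelation.{u} s) : Type (u + 1) where
  carrier : Type u
  [cstar : NonUnitalCStarAlgebra carrier]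
  tuple : Fin s → carrier
  holds : R carrier tuple

attribute [instance] CStarRep.cstar

/-- The bounded product of the C*-algebras in which the representations of `R` live. -/
abbrev CStarRepProd {s : ℕ} (R : CStarRelation.{u} s) : Type (u + 1) :=
  lp (fun ρ : CStarRep R => ρ.carrier) ∞

/-- The canonical generators inside the bounded product: the elements whose coordinate
at each representation is the `k`-th entry of that representation, for some `k`. (If the entries
are uniformly bounded over all representations, there is one such element for each `k`.) -/
def canonicalGenerators {s : ℕ} (R : CStarRelation.{u} s) : Set (CStarRepProd R) :=
  {f | ∃ k : Fin s, ∀ ρ : CStarRep R, f ρ = ρ.tuple k}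

/-- The closed *-subalgebra of the bounded product generated by the canonical generators. -/
noncomputable def universalSubalgebra {s : ℕ} (R : CStarRelation.{u} s) :
    NonUnitalStarSubalgebra ℂ (CStarRepProd R) :=
  (NonUnitalStarAlgebra.adjoin ℂ (canonicalGenerators R)).topologicalClosure

/-- The universal C*-algebra `C*⟨x_1, …, x_s | R⟩`: the closed *-subalgebra that the canonical
generators generate in the bounded product over all representations of `R`. -/
def UniversalCStar {s : ℕ} (R : CStarRelation.{u} s) : Type (u + 1) :=
  universalSubalgebra R

noncomputable instance {s : ℕ} (R : CStarRelation.{u} s) :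
    NonUnitalCStarAlgebra (UniversalCStar R) :=
  NonUnitalStarSubalgebra.nonUnitalCStarAlgebra (universalSubalgebra R)
    (h_closed := NonUnitalStarSubalgebra.isClosed_topologicalClosure _)

/-- The coordinate *-homomorphism at a representation. -/
noncomputable def UniversalCStar.proj {s : ℕ} {R : CStarRelation.{u} s} (ρ : CStarRep R) :
    UniversalCStar R →⋆ₙₐ[ℂ] ρ.carrier where
  toFun a := a.1 ρ
  map_smul' _ _ := rfl
  map_zero' := rfl
  map_add' _ _ := rfl
  map_mul' _ _ := rfl
  map_star' _ := rfl

end Universal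

/-- The relations `‖∑ₖ (xₖ xₖ^*)^{q/2}‖ ≤ 1` and `‖p_j(x_1, …, x_s)‖ ≤ C_j`. The power is taken
in the continuous functional calculus of the positive element `xₖ xₖ^*`. -/
def SoftBallRelation {s J : ℕ} (q : ℝ) (p : Fin J → NCStarPoly s) (C : Fin J → ℝ)
    (A : Type v) [NonUnitalCStarAlgebra A] (x : Fin s → A) : Prop :=
  ‖∑ k, cfcₙ (fun t : ℝ => t ^ (q / 2)) (x k * star (x k))‖ ≤ 1 ∧
    ∀ j, ‖(p j).eval x‖ ≤ C j

section Checks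

/-- The value of a polynomial is natural in the C*-algebra. -/
theorem NCStarPoly.map_eval {s : ℕ} (p : NCStarPoly s) {A : Type v} {B : Type w}
    [NonUnitalCStarAlgebra A] [NonUnitalCStarAlgebra B] (φ : A →⋆ₙₐ[ℂ] B) (x : Fin s → A) :
    φ (p.eval x) = p.eval (fun k => φ (x k)) := by
  have h : ((φ : A →ₙₐ[ℂ] B).comp (MonoidAlgebra.liftMagma ℂ
      (FreeSemigroup.lift (Sum.elim x (fun k => star (x k)))))) =
      MonoidAlgebra.liftMagma ℂ
        (FreeSemigroup.lift (Sum.elim (fun k => φ (x k)) (fun k => star (φ (x k))))) := by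
    apply (MonoidAlgebra.liftMagma ℂ).symm.injective
    rw [Equiv.symm_apply_apply]
    ext l
    rcases l with k | k
    · simp [MonoidAlgebra.liftMagma_symm_apply]
      rfl
    · simp [MonoidAlgebra.liftMagma_symm_apply]
      exact map_star φ (x k)
  exact DFunLike.congr_fun h p

/-- The ball relation bounds the generators by one. -/
theorem SoftBallRelation.norm_le_one {s J : ℕ} {q : ℝ} (hq : 0 < q) {p : Fin J → NCStarPoly s}
    {C : Fin J → ℝ} {A : Type v} [NonUnitalCStarAlgebra A] {x : Fin s → A}
    (h : SoftBallRelation q p C A x) (k : Fin s) : ‖x k‖ ≤ 1 := by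
  let _ : PartialOrder A := CStarAlgebra.spectralOrder A
  have : StarOrderedRing A := CStarAlgebra.spectralOrderedRing A
  have hq' : q / 2 ≠ 0 := by positivity
  have hcont : Continuous (fun t : ℝ => t ^ (q / 2)) :=
    Real.continuous_rpow_const (by positivity)
  have hpos : ∀ i, 0 ≤ x i * star (x i) := fun i => mul_star_self_nonneg _
  have hspec : ∀ i, ∀ t ∈ quasispectrum ℝ (x i * star (x i)), 0 ≤ t :=
    fun i t ht => quasispectrum_nonneg_of_nonneg _ (hpos i) t ht
  have hn : ∀ i, 0 ≤ cfcₙ (fun t : ℝ => t ^ (q / 2)) (x i * star (x i)) := fun i =>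
    cfcₙ_nonneg fun t ht => Real.rpow_nonneg (hspec i t ht) _
  have h1 : ‖cfcₙ (fun t : ℝ => t ^ (q / 2)) (x k * star (x k))‖ ≤ 1 :=
    (CStarAlgebra.norm_le_norm_of_nonneg_of_le (hn k)
      (Finset.single_le_sum (f := fun i => cfcₙ (fun t : ℝ => t ^ (q / 2)) (x i * star (x i)))
        (fun i _ => hn i) (Finset.mem_univ k))).trans h.1
  have hsa : IsSelfAdjoint (x k * star (x k)) := IsSelfAdjoint.mul_star_self _
  have h2 : ‖x k * star (x k)‖ ≤ 1 := by
    rw [← cfcₙ_id' ℝ (x k * star (x k))]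
    refine norm_cfcₙ_le fun t ht => ?_
    have h3 : ‖t ^ (q / 2)‖ ≤ 1 :=
      (norm_apply_le_norm_cfcₙ (fun t : ℝ => t ^ (q / 2)) (x k * star (x k)) ht
        hcont.continuousOn (Real.zero_rpow hq')).trans h1
    have h0 := hspec k t ht
    rw [Real.norm_of_nonneg (Real.rpow_nonneg h0 _)] at h3
    rw [Real.norm_of_nonneg h0]
    by_contra! hlt
    exact absurd h3 (not_le.2 (Real.one_lt_rpow hlt (by positivity)))
  rw [CStarRing.norm_self_mul_star] at h2
  nlinarith [norm_nonneg (x k)]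

/-- The universal property: the universal C*-algebra of the relations contains a
tuple `X` that satisfies the relations, and for every tuple `b` in a C*-algebra `B` that satisfies
them there is exactly one *-homomorphism with `X k ↦ b k`. -/
theorem UniversalCStar.universal {s J : ℕ} {q : ℝ} (hq : 0 < q) (p : Fin J → NCStarPoly s)
    (C : Fin J → ℝ) (hC : ∀ j, 0 ≤ C j) :
    ∃ X : Fin s → UniversalCStar.{u} (SoftBallRelation.{u} q p C),
      SoftBallRelation q p C _ X ∧
      (∀ (ρ : CStarRep (SoftBallRelation.{u} q p C)) (k : Fin s),
        UniversalCStar.proj ρ (X k) = ρ.tuple k) ∧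
      ∀ (B : Type u) [NonUnitalCStarAlgebra B] (b : Fin s → B), SoftBallRelation q p C B b →
        ∃! φ : UniversalCStar.{u} (SoftBallRelation.{u} q p C) →⋆ₙₐ[ℂ] B, ∀ k, φ (X k) = b k := by
  set R : CStarRelation.{u} s := SoftBallRelation.{u} q p C with hR
  let X₀ : Fin s → CStarRepProd R := fun k =>
    ⟨fun ρ => ρ.tuple k, memℓp_infty ⟨1, by
      rintro _ ⟨ρ, rfl⟩; exact SoftBallRelation.norm_le_one hq ρ.holds k⟩⟩
  have hX₀ : ∀ k, X₀ k ∈ canonicalGenerators R := fun k => ⟨k, fun ρ => rfl⟩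
  let X : Fin s → UniversalCStar R := fun k =>
    ⟨X₀ k, NonUnitalStarSubalgebra.le_topologicalClosure _
      (NonUnitalStarAlgebra.subset_adjoin ℂ _ (hX₀ k))⟩
  have hproj : ∀ (ρ : CStarRep R) (k : Fin s), UniversalCStar.proj ρ (X k) = ρ.tuple k :=
    fun ρ k => rfl
  have hcont : Continuous (fun t : ℝ => t ^ (q / 2)) :=
    Real.continuous_rpow_const (by positivity)
  have hnorm : ∀ (a : UniversalCStar R) (c : ℝ), 0 ≤ c →
      (∀ ρ : CStarRep R, ‖UniversalCStar.proj ρ a‖ ≤ c) → ‖a‖ ≤ c :=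
    fun a c hc h => lp.norm_le_of_forall_le (f := a.1) hc h
  refine ⟨X, ⟨?_, fun j => ?_⟩, hproj, fun B _ b hb => ?_⟩
  · refine hnorm _ 1 zero_le_one fun ρ => ?_
    rw [map_sum]
    convert ρ.holds.1 using 3 with k
    have hφ : Continuous (UniversalCStar.proj ρ) :=
      AddMonoidHomClass.continuous_of_bound _ 1
        (by simpa only [one_mul] using NonUnitalStarAlgHom.norm_apply_le _)
    rw [NonUnitalStarAlgHomClass.map_cfcₙ (S := ℂ) (UniversalCStar.proj ρ) (fun t : ℝ => t ^ (q / 2))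
      (X k * star (X k)) hcont.continuousOn (Real.zero_rpow (by positivity)) hφ
      (IsSelfAdjoint.mul_star_self _) ((IsSelfAdjoint.mul_star_self _).map _),
      map_mul, map_star, hproj]
  · refine hnorm _ _ (hC j) fun ρ => ?_
    rw [NCStarPoly.map_eval]
    exact ρ.holds.2 j
  · refine ⟨UniversalCStar.proj ⟨B, b, hb⟩, fun k => rfl, fun φ hφ => ?_⟩
    have hφc : Continuous φ :=
      AddMonoidHomClass.continuous_of_bound _ 1
        (by simpa only [one_mul] using NonUnitalStarAlgHom.norm_apply_le _)
    have hψc : Continuous (UniversalCStar.proj (R := R) ⟨B, b, hb⟩) :=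
      AddMonoidHomClass.continuous_of_bound _ 1
        (by simpa only [one_mul] using NonUnitalStarAlgHom.norm_apply_le _)
    have key : ∀ a (ha : a ∈ NonUnitalStarAlgebra.adjoin ℂ (canonicalGenerators R)),
        φ ⟨a, NonUnitalStarSubalgebra.le_topologicalClosure _ ha⟩ =
          UniversalCStar.proj (R := R) ⟨B, b, hb⟩
            ⟨a, NonUnitalStarSubalgebra.le_topologicalClosure _ ha⟩ := by
      intro a ha
      induction ha using NonUnitalStarAlgebra.adjoin_induction with
      | mem a ha =>
        obtain ⟨k, hk⟩ := ha
        have : a = X₀ k := lp.ext (funext hk)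
        subst this
        exact hφ k
      | add a c ha hc iha ihc => exact (map_add φ _ _).trans (congrArg₂ (· + ·) iha ihc)
      | zero => exact map_zero φ
      | mul a c ha hc iha ihc => exact (map_mul φ _ _).trans (congrArg₂ (· * ·) iha ihc)
      | smul t a ha iha => exact (map_smul φ t _).trans (congrArg (t • ·) iha)
      | star a ha iha => exact (map_star φ _).trans (congrArg star iha)
    ext ⟨a, ha⟩
    have hcl : IsClosed {z : UniversalCStar R | φ z = UniversalCStar.proj (R := R) ⟨B, b, hb⟩ z} :=
      isClosed_eq hφc hψc
    have hd : (⟨a, ha⟩ : UniversalCStar R) ∈ closure {z : UniversalCStar R |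
        z.1 ∈ NonUnitalStarAlgebra.adjoin ℂ (canonicalGenerators R)} := by
      refine closure_subtype.2 (closure_mono ?_ ha)
      intro y hy
      exact ⟨⟨y, NonUnitalStarSubalgebra.le_topologicalClosure _ hy⟩, hy, rfl⟩
    exact hcl.closure_subset_iff.2 (fun z hz => key z.1 hz) hd

end Checks

/-! ### Functional calculus and approximate units in kernels. -/

section Lifting

/-! By the universal property, projectivity says that a tuple in a quotient `D` satisfying the
relations lifts to a tuple in `B` satisfying the same relations (`SoftBallRelation.exists_lift`).
The lift is made in two stages.

The ball relation alone (`exists_lift_ball`): lift the positive elements `(xₖxₖ*)^{q/2}` to positive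
`aₖ` with `‖∑ aₖ‖ ≤ 1`, put `bₖ = aₖ^{2/q}`, and lift `xₖ` to `Xₖ` with `XₖXₖ* ≤ bₖ`
(`exists_lift_mul_star_le`). Since `q/2 ≤ 1`, the power `t^{q/2}` is operator monotone, so `∑
(XₖXₖ*)^{q/2} ≤ ∑ aₖ`. For the same reason, any later change that decreases every `XₖXₖ*` keeps the
ball relation.

The polynomial bounds (`exists_lift_eval_le`): multiply the first `r` variables on the right by `h =
1 - δe`, with `e` from a quasi-central approximate unit of `ker ρ`. This leaves the images unchanged
and decreases `XₖXₖ*`. By homogeneity and asymptotic centrality, `p_j(X)` turns into nearly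
`p_j(X)h^{d_j}`. The part of `p_j(X)* p_j(X)` above `C_j²` lies in the kernel, so `e` nearly acts on
it as a unit and one factor `h` already brings the norm down to about `C_j`
(`norm_sq_mul_one_sub_smul_le`). An excess `ε` costs a perturbation of order `ε`; with geometrically
decreasing excesses the iteration converges to an exact lift. -/

theorem NonUnitalStarAlgHom.continuous_of_cstar {A : Type v} {B : Type w}
    [NonUnitalCStarAlgebra A] [NonUnitalCStarAlgebra B] (φ : A →⋆ₙₐ[ℂ] B) : Continuous φ :=
  AddMonoidHomClass.continuous_of_bound _ 1
    (by simpa only [one_mul] using NonUnitalStarAlgHom.norm_apply_le _)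

theorem NonUnitalStarAlgHom.map_real_cfcₙ {A : Type v} {B : Type w}
    [NonUnitalCStarAlgebra A] [NonUnitalCStarAlgebra B] (φ : A →⋆ₙₐ[ℂ] B) {f : ℝ → ℝ}
    (hf : Continuous f) (hf0 : f 0 = 0) {a : A} (ha : IsSelfAdjoint a) :
    φ (cfcₙ f a) = cfcₙ f (φ a) :=
  NonUnitalStarAlgHomClass.map_cfcₙ (S := ℂ) φ f a hf.continuousOn hf0
    φ.continuous_of_cstar ha (ha.map φ)

variable {A : Type v} {D : Type w} [NonUnitalCStarAlgebra A] [NonUnitalCStarAlgebra D]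

/-- The truncated identity `t ↦ t / (|t| + ε)`, which tends to `1` on positive reals. -/
noncomputable def cutoff (ε t : ℝ) : ℝ := t / (|t| + ε)

theorem continuous_cutoff {ε : ℝ} (hε : 0 < ε) : Continuous (cutoff ε) :=
  continuous_id.div (by fun_prop) fun t => by positivity

theorem cutoff_zero (ε : ℝ) : cutoff ε 0 = 0 := by simp [cutoff]

theorem cutoff_nonneg {ε t : ℝ} (hε : 0 < ε) (ht : 0 ≤ t) : 0 ≤ cutoff ε t := by
  unfold cutoff; positivity

theorem abs_cutoff_le_one {ε t : ℝ} (hε : 0 < ε) : |cutoff ε t| ≤ 1 := by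
  rw [cutoff, abs_div, div_le_one (by positivity), abs_of_pos (a := |t| + ε) (by positivity)]
  linarith

theorem mul_one_sub_cutoff_sq_le {ε t : ℝ} (hε : 0 < ε) (ht : 0 ≤ t) :
    t * (1 - cutoff ε t) ^ 2 ≤ ε := by
  have h : 1 - cutoff ε t = ε / (t + ε) := by
    rw [cutoff, abs_of_nonneg ht]; field_simp; ring
  rw [h, div_pow, mul_div_assoc', div_le_iff₀ (by positivity)]
  nlinarith [mul_nonneg ht hε.le, mul_nonneg (mul_nonneg ht hε.le) hε.le, pow_pos hε 3,
    mul_nonneg (mul_nonneg ht ht) hε.le]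

section Order

variable [PartialOrder A] [StarOrderedRing A]

theorem norm_le_norm_of_mul_star_le {a c : A} (h : a * star a ≤ c * star c) : ‖a‖ ≤ ‖c‖ := by
  have := CStarAlgebra.norm_le_norm_of_nonneg_of_le (mul_star_self_nonneg a) h
  rw [CStarRing.norm_self_mul_star, CStarRing.norm_self_mul_star] at this
  nlinarith [norm_nonneg a, norm_nonneg c]

/-- Used to replace a factor that does not commute with the functional calculus by a square root
that does. -/
theorem norm_mul_le_norm_mul_of_mul_star_le {a c : A} (z : A) (h : a * star a ≤ c * star c) :
    ‖z * a‖ ≤ ‖z * c‖ := by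
  apply norm_le_norm_of_mul_star_le
  simpa only [star_mul, mul_assoc] using star_right_conjugate_le_conjugate h z

/-- The positive square root as an element of the real functional calculus. -/
theorem exists_sqrt {b : A} (hb : 0 ≤ b) :
    IsSelfAdjoint (cfcₙ Real.sqrt b) ∧ cfcₙ Real.sqrt b * cfcₙ Real.sqrt b = b := by
  refine ⟨IsSelfAdjoint.cfcₙ, ?_⟩
  rw [← CFC.sqrt_eq_real_sqrt b hb]
  exact CFC.sqrt_mul_sqrt_self b hb

/-- Formally, `(1-e)aa*(1-e) ≤ (1-e)b(1-e)` for `e = cutoff ε b`. The right side is a function of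
`b` alone, namely `t(1 - cutoff ε t)²`, which is at most `ε` on `t ≥ 0`. -/
theorem norm_sub_cutoff_mul_le {ε : ℝ} (hε : 0 < ε) {a b : A} (h : a * star a ≤ b) :
    ‖a - cfcₙ (cutoff ε) b * a‖ ^ 2 ≤ ε := by
  have hb : 0 ≤ b := (mul_star_self_nonneg a).trans h
  have hbs : IsSelfAdjoint b := .of_nonneg hb
  set e := cfcₙ (cutoff ε) b with he
  have hes : IsSelfAdjoint e := IsSelfAdjoint.cfcₙ
  obtain ⟨c, hc⟩ := CStarAlgebra.nonneg_iff_eq_mul_star_self.1 (sub_nonneg.2 h)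
  have hg := continuous_cutoff hε
  -- There is no unit to conjugate with, so `1 - e` is expanded; the difference of the two sides is
  -- `(c - ec)(c - ec)*` where `cc* = b - aa*`.
  have h1 : (a - e * a) * star (a - e * a) ≤ b - e * b - b * e + e * b * e := by
    rw [← sub_nonneg]
    have : b - e * b - b * e + e * b * e - (a - e * a) * star (a - e * a) =
        (c - e * c) * star (c - e * c) := by
      have hb' : b = c * star c + a * star a := by rw [← hc]; abel
      simp only [star_sub, star_mul, hes.star_eq]
      generalize e = f at *
      rw [hb']
      noncomm_ring
    rw [this]
    exact mul_star_self_nonneg _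
  have h2 : b - e * b - b * e + e * b * e =
      cfcₙ (fun t => t * (1 - cutoff ε t) ^ 2) b := by
    have : (fun t => t * (1 - cutoff ε t) ^ 2) = fun t =>
        t - cutoff ε t * t - t * cutoff ε t + cutoff ε t * t * cutoff ε t := by
      ext t; ring
    rw [this, cfcₙ_add (fun t => t - cutoff ε t * t - t * cutoff ε t)
      (fun t => cutoff ε t * t * cutoff ε t) b
      (by fun_prop) (by simp) (by fun_prop) (by simp),
      cfcₙ_sub (fun t => t - cutoff ε t * t) (fun t => t * cutoff ε t) b
      (by fun_prop) (by simp) (by fun_prop) (by simp),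
      cfcₙ_sub (fun t => t) (fun t => cutoff ε t * t) b
      (by fun_prop) (by simp) (by fun_prop) (by simp),
      cfcₙ_mul (fun t => cutoff ε t * t) (cutoff ε) b
      (by fun_prop) (by simp) (by fun_prop) (cutoff_zero ε),
      cfcₙ_mul (cutoff ε) (fun t => t) b
      (by fun_prop) (cutoff_zero ε) (by fun_prop) (by simp),
      cfcₙ_mul (fun t => t) (cutoff ε) b
      (by fun_prop) (by simp) (by fun_prop) (cutoff_zero ε), cfcₙ_id' ℝ b]
  rw [pow_two, ← CStarRing.norm_self_mul_star]
  refine (CStarAlgebra.norm_le_norm_of_nonneg_of_le (mul_star_self_nonneg _) h1).trans ?_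
  rw [h2]
  refine norm_cfcₙ_le fun t ht => ?_
  have ht0 := quasispectrum_nonneg_of_nonneg _ hb t ht
  rw [Real.norm_of_nonneg (by positivity)]
  exact mul_one_sub_cutoff_sq_le hε ht0

/-- Finitely many elements of the kernel of a *-homomorphism have a common approximate right unit
in the kernel. -/
theorem exists_approximate_unit_ker (ρ : A →⋆ₙₐ[ℂ] D) (G : Finset A) (hG : ∀ g ∈ G, ρ g = 0)
    {ε : ℝ} (hε : 0 < ε) :
    ∃ e : A, ρ e = 0 ∧ 0 ≤ e ∧ ‖e‖ ≤ 1 ∧ ∀ g ∈ G, ‖g - g * e‖ ≤ ε := by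
  have hε2 : 0 < ε ^ 2 := by positivity
  set b := ∑ g ∈ G, star g * g with hbdef
  have hb : 0 ≤ b := Finset.sum_nonneg fun g _ => star_mul_self_nonneg g
  have hρ : ρ b = 0 := by
    rw [hbdef, map_sum]
    exact Finset.sum_eq_zero fun g hg => by rw [map_mul, hG g hg, mul_zero]
  -- `cutoff` vanishes at `0`, so the functional calculus stays in the kernel; the parameter `ε²`
  -- compensates for the squared norm in `norm_sub_cutoff_mul_le`.
  refine ⟨cfcₙ (cutoff (ε ^ 2)) b, ?_, ?_, ?_, fun g hg => ?_⟩
  · rw [ρ.map_real_cfcₙ (continuous_cutoff hε2) (cutoff_zero _) (.of_nonneg hb), hρ,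
      cfcₙ_apply_zero]
  · exact cfcₙ_nonneg fun t ht => cutoff_nonneg hε2 (quasispectrum_nonneg_of_nonneg _ hb t ht)
  · exact norm_cfcₙ_le fun t _ => abs_cutoff_le_one hε2
  · have h : star g * star (star g) ≤ b := by
      rw [star_star]
      exact Finset.single_le_sum (f := fun g => star g * g)
        (fun g _ => star_mul_self_nonneg g) hg
    have := norm_sub_cutoff_mul_le hε2 h
    rw [← norm_star, star_sub, star_mul, star_star,
      (IsSelfAdjoint.cfcₙ : IsSelfAdjoint (cfcₙ (cutoff (ε ^ 2)) b)).star_eq] at this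
    exact (sq_le_sq₀ (norm_nonneg _) hε.le).1 this

end Order

end Lifting

/-! ### Quasi-central approximate units by averaging. -/

section QuasiCentral

variable {A : Type v} {D : Type w} [NonUnitalCStarAlgebra A] [NonUnitalCStarAlgebra D]

/-- An approximate Pythagoras: if `z*y` is small, squared norms nearly add. This gives sums of `n`
commutators the order `√n` instead of `n`. -/
theorem norm_add_sq_le_of_star_mul (z y : A) :
    ‖z + y‖ ^ 2 ≤ ‖z‖ ^ 2 + ‖y‖ ^ 2 + 2 * ‖star z * y‖ := by
  have h1 : ‖star y * z‖ = ‖star z * y‖ := by rw [← norm_star, star_mul, star_star]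
  calc ‖z + y‖ ^ 2 = ‖star z * z + star y * y + star z * y + star y * z‖ := by
        rw [pow_two, ← CStarRing.norm_star_mul_self]
        congr 1
        rw [star_add]
        noncomm_ring
    _ ≤ ‖star z * z‖ + ‖star y * y‖ + ‖star z * y‖ + ‖star y * z‖ := norm_add₄_le
    _ = _ := by
        rw [CStarRing.norm_star_mul_self, CStarRing.norm_star_mul_self, h1]
        ring

variable [PartialOrder A] [StarOrderedRing A]

/-- Sums of `n` far apart members of an approximate unit of the kernel of a *-homomorphism have
commutators of order `√n` with finitely many given elements. -/
theorem exists_sum_approximate_unit (ρ : A →⋆ₙₐ[ℂ] D) (F G : Finset A)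
    (hG : ∀ g ∈ G, ρ g = 0) {ε : ℝ} (hε : 0 < ε) (n : ℕ) :
    ∃ S : A, ρ S = 0 ∧ 0 ≤ S ∧ ‖S‖ ≤ n ∧ (∀ g ∈ G, ‖(n : ℝ) • g - g * S‖ ≤ n * ε) ∧
      ∀ x ∈ F, ‖S * x - x * S‖ ^ 2 ≤ n * (4 * ‖x‖ ^ 2 + 1) := by
  classical
  induction n with
  | zero => exact ⟨0, by simp, le_rfl, by simp, by simp, by simp⟩
  | succ n ih =>
    obtain ⟨S, hS0, hSp, hSn, hSG, hSF⟩ := ih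
    set z : A → A := fun x => S * x - x * S with hz
    set M : ℝ := 4 * (1 + ∑ x ∈ F, ‖x‖) with hM
    have hMx : ∀ x ∈ F, 4 * (1 + ‖x‖) ≤ M := fun x hx => by
      have := Finset.single_le_sum (f := fun x : A => ‖x‖) (fun _ _ => norm_nonneg _) hx
      linarith
    have hM0 : 0 < M := by positivity
    have hρz : ∀ x, ρ (z x) = 0 := fun x => by simp [hz, hS0]
    -- The old commutator `z x = [S, x]` lies in the kernel. If `e` is nearly a right unit for `z*`
    -- and `z*x`, then `z*[e, x]` is small, so the new commutator is nearly orthogonal to the old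
    -- one.
    obtain ⟨e, he0, hep, hen, heG⟩ := exists_approximate_unit_ker ρ
      (G ∪ F.image (fun x => star (z x)) ∪ F.image (fun x => star (z x) * x))
      (by
        intro g hg
        simp only [Finset.mem_union, Finset.mem_image] at hg
        rcases hg with (hg | ⟨x, _, rfl⟩) | ⟨x, _, rfl⟩
        · exact hG g hg
        · rw [map_star, hρz, star_zero]
        · rw [map_mul, map_star, hρz, star_zero, zero_mul])
      (ε := min ε (1 / M)) (by positivity)
    refine ⟨S + e, by simp [hS0, he0], add_nonneg hSp hep, ?_, fun g hg => ?_, fun x hx => ?_⟩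
    · push_cast
      exact (norm_add_le _ _).trans (add_le_add hSn hen)
    · have h1 := (heG g (by simp [hg])).trans (min_le_left _ _)
      have h2 : ((n + 1 : ℕ) : ℝ) • g - g * (S + e) = ((n : ℝ) • g - g * S) + (g - g * e) := by
        push_cast
        rw [add_smul, one_smul, mul_add]
        abel
      rw [h2]
      push_cast
      linarith [norm_add_le ((n : ℝ) • g - g * S) (g - g * e), hSG g hg]
    · have h1 := (heG (star (z x))
        (Finset.mem_union_left _ (Finset.mem_union_right _
          (Finset.mem_image_of_mem (fun x => star (z x)) hx)))).trans (min_le_right _ _)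
      have h2 := (heG (star (z x) * x)
        (Finset.mem_union_right _
          (Finset.mem_image_of_mem (fun x => star (z x) * x) hx))).trans (min_le_right _ _)
      have h3 : (S + e) * x - x * (S + e) = z x + (e * x - x * e) := by
        simp only [hz]
        noncomm_ring
      have h4 : star (z x) * (e * x - x * e) =
          (star (z x) * x - star (z x) * x * e) - (star (z x) - star (z x) * e) * x := by
        noncomm_ring
      have h5 : ‖star (z x) * (e * x - x * e)‖ ≤ 1 / 4 := by
        rw [h4]
        calc _ ≤ ‖star (z x) * x - star (z x) * x * e‖ + ‖(star (z x) - star (z x) * e) * x‖ :=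
              norm_sub_le _ _
          _ ≤ 1 / M + 1 / M * ‖x‖ := add_le_add h2 ((norm_mul_le _ _).trans
              (mul_le_mul_of_nonneg_right h1 (norm_nonneg _)))
          _ = (1 + ‖x‖) / M := by ring
          _ ≤ 1 / 4 := by
              rw [div_le_div_iff₀ hM0 (by norm_num)]
              linarith [hMx x hx]
      have h6 : ‖e * x - x * e‖ ≤ 2 * ‖x‖ := by
        refine (norm_sub_le _ _).trans ?_
        have h7 := norm_mul_le e x
        have h8 := norm_mul_le x e
        nlinarith [norm_nonneg x]
      rw [h3]
      refine (norm_add_sq_le_of_star_mul _ _).trans ?_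
      have h9 := hSF x hx
      have h10 : ‖e * x - x * e‖ ^ 2 ≤ (2 * ‖x‖) ^ 2 := pow_le_pow_left₀ (norm_nonneg _) h6 2
      push_cast
      simp only [hz] at h5 ⊢
      nlinarith

/-- Kernels of *-homomorphisms have approximate units that are quasi-central. -/
theorem exists_quasicentral_approximate_unit (ρ : A →⋆ₙₐ[ℂ] D) (F G : Finset A)
    (hG : ∀ g ∈ G, ρ g = 0) {ε : ℝ} (hε : 0 < ε) :
    ∃ e : A, ρ e = 0 ∧ 0 ≤ e ∧ ‖e‖ ≤ 1 ∧ (∀ g ∈ G, ‖g - g * e‖ ≤ ε) ∧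
      ∀ x ∈ F, ‖e * x - x * e‖ ≤ ε := by
  set K : ℝ := ∑ x ∈ F, (4 * ‖x‖ ^ 2 + 1) with hK
  have hKx : ∀ x ∈ F, 4 * ‖x‖ ^ 2 + 1 ≤ K := fun x hx =>
    Finset.single_le_sum (f := fun x : A => 4 * ‖x‖ ^ 2 + 1) (fun _ _ => by positivity) hx
  -- For the average `S/n` the commutators are at most `√(K/n)`, which is `≤ ε` once `n ≥ K/ε²`.
  obtain ⟨m, hm⟩ := exists_nat_ge (K / ε ^ 2)
  set n := m + 1 with hn
  have hn0 : (0 : ℝ) < n := by rw [hn]; positivity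
  have hnK : K ≤ n * ε ^ 2 := by
    rw [div_le_iff₀ (by positivity)] at hm
    rw [hn]
    push_cast
    nlinarith [sq_nonneg ε]
  obtain ⟨S, hS0, hSp, hSn, hSG, hSF⟩ := exists_sum_approximate_unit ρ F G hG hε n
  have hsm : ∀ y : A, ‖(n : ℝ)⁻¹ • y‖ = (n : ℝ)⁻¹ * ‖y‖ := fun y => by
    rw [norm_smul, Real.norm_of_nonneg (by positivity)]
  refine ⟨(n : ℝ)⁻¹ • S, ?_, smul_nonneg (by positivity) hSp, ?_, fun g hg => ?_, fun x hx => ?_⟩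
  · have : (n : ℝ)⁻¹ • S = ((n : ℂ)⁻¹) • S := by
      rw [← Complex.coe_smul]
      simp
    rw [this, map_smul, hS0, smul_zero]
  · rw [hsm, inv_mul_le_iff₀ hn0, mul_one]
    exact hSn
  · have : g - g * (n : ℝ)⁻¹ • S = (n : ℝ)⁻¹ • ((n : ℝ) • g - g * S) := by
      rw [smul_sub, smul_smul, inv_mul_cancel₀ hn0.ne', one_smul, mul_smul_comm]
    rw [this, hsm, inv_mul_le_iff₀ hn0]
    exact hSG g hg
  · rw [smul_mul_assoc, mul_smul_comm, ← smul_sub, hsm, inv_mul_le_iff₀ hn0]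
    refine abs_le_of_sq_le_sq' ?_ (by positivity) |>.2
    have := (hSF x hx).trans (mul_le_mul_of_nonneg_left (hKx x hx) hn0.le)
    nlinarith

end QuasiCentral

/-! ### Lifting the ball relation. -/

section BallLifting

variable {A : Type v} {D : Type w} [NonUnitalCStarAlgebra A] [NonUnitalCStarAlgebra D]
  [PartialOrder A] [StarOrderedRing A]

open Filter Topology in
/-- An element `x` of a quotient with `x x^* = ρ b`, `b` positive, lifts to an `X` with
`X X^* ≤ b`. -/
theorem exists_lift_mul_star_le (ρ : A →⋆ₙₐ[ℂ] D) (hρ : Function.Surjective ρ) {x : D} {b : A}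
    (hb : 0 ≤ b) (hx : ρ b = x * star x) : ∃ X : A, ρ X = x ∧ X * star X ≤ b := by
  let _ : PartialOrder D := CStarAlgebra.spectralOrder D
  have : StarOrderedRing D := CStarAlgebra.spectralOrderedRing D
  obtain ⟨Y, rfl⟩ := hρ x
  have hbs : IsSelfAdjoint b := .of_nonneg hb
  have hYb : IsSelfAdjoint (Y * star Y - b) := (IsSelfAdjoint.mul_star_self Y).sub hbs
  -- `w` dominates both `b` and `YY*`, and has the same image as `b` because `ρ(YY* - b) = 0`. The
  -- lift is then `b^{1/2} w^{-1/2} Y` in regularized form.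
  set w := b + (Y * star Y - b)⁺ with hw
  have hbw : b ≤ w := le_add_of_nonneg_right (CFC.posPart_nonneg _)
  have hYw : Y * star Y ≤ w := by
    have := CFC.le_posPart hYb
    rw [hw]
    exact sub_le_iff_le_add'.1 this
  have hw0 : 0 ≤ w := hb.trans hbw
  have hws : IsSelfAdjoint w := .of_nonneg hw0
  have hρw : ρ w = ρ b := by
    rw [hw, map_add, CFC.posPart_def, ρ.map_real_cfcₙ (by fun_prop) (by simp) hYb]
    simp [hx, map_star]
  have hρbs : IsSelfAdjoint (ρ b) := hbs.map ρ
  have hρb0 : 0 ≤ ρ b := by rw [hx]; exact mul_star_self_nonneg _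
  obtain ⟨hrs, hrr⟩ := exists_sqrt hb
  set R := cfcₙ Real.sqrt b with hR
  obtain ⟨hqs, hqq⟩ := exists_sqrt hw0
  set Q := cfcₙ Real.sqrt w with hQ
  let ε : ℕ → ℝ := fun n => 1 / ((n : ℝ) + 1)
  have hε : ∀ n, 0 < ε n := fun n => by positivity
  have hε0 : Tendsto ε atTop (𝓝 0) := tendsto_one_div_add_atTop_nhds_zero_nat
  let f : ℕ → ℝ → ℝ := fun n t => √t / (|t| + ε n)
  have hf : ∀ n, Continuous (f n) := fun n =>
    Real.continuous_sqrt.div (by fun_prop) fun t => by have := hε n; positivity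
  have hf0 : ∀ n, f n 0 = 0 := fun n => by simp [f]
  -- `f n` is a continuous substitute for `t^{-1/2}` that vanishes at `0`.
  have hfg : ∀ n t, 0 ≤ t → √t * f n t = cutoff (ε n) t := fun n t ht => by
    simp only [f, cutoff]
    rw [mul_div_assoc', Real.mul_self_sqrt ht]
  have hfs : ∀ n, IsSelfAdjoint (cfcₙ (f n) w) := fun n => IsSelfAdjoint.cfcₙ
  let X : ℕ → A := fun n => R * cfcₙ (f n) w * Y
  have hYQ : Y * star Y ≤ Q * star Q := by rwa [hqs.star_eq, hqq]
  have hRQ : R * star R ≤ Q * star Q := by rwa [hqs.star_eq, hqq, hrs.star_eq, hrr]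
  have hest : ∀ n t, 0 ≤ t → |√t * f n t * √t - √t| ≤ √(ε n) := fun n t ht => by
    have h1 : √t * f n t * √t - √t = -(√t * (1 - cutoff (ε n) t)) := by
      rw [hfg n t ht]; ring
    rw [h1, abs_neg]
    apply Real.abs_le_sqrt
    rw [mul_pow, Real.sq_sqrt ht]
    exact mul_one_sub_cutoff_sq_le (hε n) ht
  have hdist : ∀ n m, ‖X n - X m‖ ≤ √(ε n) + √(ε m) := fun n m => by
    set E := cfcₙ (f n) w - cfcₙ (f m) w with hE
    have hEs : IsSelfAdjoint E := (hfs n).sub (hfs m)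
    have h1 : X n - X m = R * E * Y := by
      simp only [X, hE]
      noncomm_ring
    have h2 : Q * E * Q = cfcₙ (fun t => √t * (f n t - f m t) * √t) w := by
      have := hf n
      have := hf m
      rw [cfcₙ_mul (fun t => √t * (f n t - f m t)) Real.sqrt w (by fun_prop) (by simp)
        (by fun_prop) (by simp), cfcₙ_mul Real.sqrt (fun t => f n t - f m t) w (by fun_prop)
        (by simp) (by fun_prop) (by simp [hf0]), cfcₙ_sub (f n) (f m) w (by fun_prop)
        (hf0 n) (by fun_prop) (hf0 m)]
    -- Both outer factors are replaced by `Q = w^{1/2}`, the left one after taking adjoints; what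
    -- remains is a function of `w`.
    rw [h1]
    calc ‖R * E * Y‖ ≤ ‖R * E * Q‖ := norm_mul_le_norm_mul_of_mul_star_le _ hYQ
      _ = ‖Q * E * R‖ := by
          rw [← norm_star, star_mul, star_mul, hqs.star_eq, hEs.star_eq, hrs.star_eq, mul_assoc]
      _ ≤ ‖Q * E * Q‖ := norm_mul_le_norm_mul_of_mul_star_le _ hRQ
      _ ≤ √(ε n) + √(ε m) := by
          rw [h2]
          refine norm_cfcₙ_le fun t ht => ?_
          have ht0 := quasispectrum_nonneg_of_nonneg _ hw0 t ht
          have h3 : √t * (f n t - f m t) * √t =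
            (√t * f n t * √t - √t) - (√t * f m t * √t - √t) := by ring
          rw [h3, Real.norm_eq_abs]
          exact (abs_sub _ _).trans (add_le_add (hest n t ht0) (hest m t ht0))
  have hsq : Tendsto (fun n => √(ε n)) atTop (𝓝 0) := by
    simpa [Function.comp_def] using (Real.continuous_sqrt.tendsto 0).comp hε0
  have hcauchy : CauchySeq X := by
    refine cauchySeq_of_le_tendsto_0 (fun n => √(ε n) + √(ε n)) (fun n m N hn hm => ?_)
      (by simpa using hsq.add hsq)
    have hmono : ∀ k, N ≤ k → √(ε k) ≤ √(ε N) := fun k hk => by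
      apply Real.sqrt_le_sqrt
      simp only [ε]
      gcongr
    rw [dist_eq_norm]
    exact (hdist n m).trans (add_le_add (hmono n hn) (hmono m hm))
  obtain ⟨Z, hZ⟩ := cauchySeq_tendsto_of_complete hcauchy
  refine ⟨Z, ?_, ?_⟩
  · have h1 : Tendsto (fun n => ρ (X n)) atTop (𝓝 (ρ Z)) :=
      (ρ.continuous_of_cstar.tendsto Z).comp hZ
    refine tendsto_nhds_unique h1 ?_
    have h2 : ∀ n, ρ (X n) = cfcₙ (cutoff (ε n)) (ρ b) * ρ Y := fun n => by
      simp only [X, map_mul]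
      rw [ρ.map_real_cfcₙ (hf n) (hf0 n) hws, hρw, hR,
        ρ.map_real_cfcₙ Real.continuous_sqrt (by simp) hbs,
        ← cfcₙ_mul Real.sqrt (f n) (ρ b) (by fun_prop) (by simp) (hf n).continuousOn (hf0 n)]
      congr 1
      exact cfcₙ_congr fun t ht => hfg n t (quasispectrum_nonneg_of_nonneg _ hρb0 t ht)
    rw [tendsto_iff_norm_sub_tendsto_zero]
    refine squeeze_zero (fun _ => norm_nonneg _) (fun n => ?_) hsq
    rw [h2, norm_sub_rev]
    exact Real.le_sqrt_of_sq_le (norm_sub_cutoff_mul_le (hε n) hx.ge)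
  · refine le_of_tendsto (hZ.mul hZ.star) (Eventually.of_forall fun n => ?_)
    set T := cfcₙ (f n) w with hT
    have h1 : X n * star (X n) ≤ R * (T * w * T) * star R := by
      have := star_right_conjugate_le_conjugate hYw (R * T)
      simpa only [X, star_mul, hT, (hfs n).star_eq, mul_assoc] using this
    have h2 : ‖T * w * T‖ ≤ 1 := by
      have := hf n
      have h3 : T * w * T = cfcₙ (fun t => f n t * t * f n t) w := by
        rw [cfcₙ_mul (fun t => f n t * t) (f n) w (by fun_prop) (by simp) (by fun_prop) (hf0 n),
          cfcₙ_mul (f n) (fun t => t) w (by fun_prop) (hf0 n) (by fun_prop) (by simp),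
          cfcₙ_id' ℝ w]
      rw [h3]
      refine norm_cfcₙ_le fun t ht => ?_
      have ht0 := quasispectrum_nonneg_of_nonneg _ hw0 t ht
      have h4 : f n t * t * f n t = cutoff (ε n) t * cutoff (ε n) t := by
        rw [← hfg n t ht0]
        nth_rewrite 2 [← Real.mul_self_sqrt ht0]
        ring
      rw [h4, Real.norm_eq_abs, abs_mul]
      have := abs_cutoff_le_one (t := t) (hε n)
      nlinarith [abs_nonneg (cutoff (ε n) t)]
    have hTs : IsSelfAdjoint (T * w * T) := by
      have := hws.conjugate_self (hfs n)
      exact this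
    refine h1.trans ((CStarAlgebra.star_right_conjugate_le_norm_smul hTs).trans ?_)
    rw [hrs.star_eq, hrr]
    exact smul_le_of_le_one_left hb h2

/-- Positive elements whose images have a contractive sum can be replaced by positive elements with
the same images and with a contractive sum. -/
theorem exists_lift_nonneg_norm_sum_le_one {ι : Type*} [Fintype ι] (ρ : A →⋆ₙₐ[ℂ] D)
    (a : ι → A) (ha : ∀ k, 0 ≤ a k) (h : ‖∑ k, ρ (a k)‖ ≤ 1) :
    ∃ a' : ι → A, (∀ k, 0 ≤ a' k) ∧ (∀ k, ρ (a' k) = ρ (a k)) ∧ ‖∑ k, a' k‖ ≤ 1 := by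
  let _ : PartialOrder D := CStarAlgebra.spectralOrder D
  have : StarOrderedRing D := CStarAlgebra.spectralOrderedRing D
  set T := ∑ k, a k with hT
  have hT0 : 0 ≤ T := Finset.sum_nonneg fun k _ => ha k
  have hTs : IsSelfAdjoint T := .of_nonneg hT0
  -- Compression by `1 + f` turns `t` into `t / max(1, √t)² = min(t, 1)`. As `f = 0` on `[0, 1]`, it
  -- does not affect the images.
  let f : ℝ → ℝ := fun t => 1 / max 1 √t - 1
  have hf : Continuous f :=
    (continuous_const.div (by fun_prop) fun t => by positivity).sub continuous_const
  have hf0 : f 0 = 0 := by simp [f]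
  set F := cfcₙ f T with hF
  have hFs : IsSelfAdjoint F := IsSelfAdjoint.cfcₙ
  have hρT0 : 0 ≤ ρ T := map_nonneg ρ hT0
  have hρF : ρ F = 0 := by
    rw [hF, ρ.map_real_cfcₙ hf hf0 hTs, ← cfcₙ_const_zero ℝ (ρ T)]
    refine cfcₙ_congr fun t ht => ?_
    have ht1 : t ≤ 1 := by
      have h1 := norm_apply_le_norm_cfcₙ (fun t : ℝ => t) (ρ T) ht
      rw [cfcₙ_id' ℝ (ρ T) (hTs.map ρ)] at h1
      rw [hT, map_sum] at h1
      exact (le_abs_self t).trans (h1.trans h)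
    have : √t ≤ 1 := Real.sqrt_le_one.2 ht1
    simp [f, max_eq_left this]
  choose s hs using fun k => CStarAlgebra.nonneg_iff_eq_mul_star_self.1 (ha k)
  have hexp : ∀ k, (s k + F * s k) * star (s k + F * s k) =
      a k + F * a k + a k * F + F * a k * F := fun k => by
    rw [hs k, star_add, star_mul, hFs.star_eq]
    noncomm_ring
  refine ⟨fun k => (s k + F * s k) * star (s k + F * s k), fun k => mul_star_self_nonneg _,
    fun k => by simp only [hexp]; simp [hρF], ?_⟩
  have hsum : ∑ k, (s k + F * s k) * star (s k + F * s k) = T + F * T + T * F + F * T * F := by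
    simp only [hexp, Finset.sum_add_distrib, hT, Finset.mul_sum, Finset.sum_mul]
  have hc : T + F * T + T * F + F * T * F =
      cfcₙ (fun t => t + f t * t + t * f t + f t * t * f t) T := by
    rw [cfcₙ_add (fun t => t + f t * t + t * f t) (fun t => f t * t * f t) T (by fun_prop)
        (by simp) (by fun_prop) (by simp),
      cfcₙ_add (fun t => t + f t * t) (fun t => t * f t) T (by fun_prop)
        (by simp) (by fun_prop) (by simp),
      cfcₙ_add (fun t => t) (fun t => f t * t) T (by fun_prop)
        (by simp) (by fun_prop) (by simp),
      cfcₙ_mul (fun t => f t * t) f T (by fun_prop) (by simp) (by fun_prop) hf0,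
      cfcₙ_mul f (fun t => t) T (by fun_prop) hf0 (by fun_prop) (by simp),
      cfcₙ_mul (fun t => t) f T (by fun_prop) (by simp) (by fun_prop) hf0,
      cfcₙ_id' ℝ T]
  rw [hsum, hc]
  refine norm_cfcₙ_le fun t ht => ?_
  have ht0 := quasispectrum_nonneg_of_nonneg _ hT0 t ht
  have h1 : t + f t * t + t * f t + f t * t * f t = (√t / max 1 √t) ^ 2 := by
    have : (√t / max 1 √t) ^ 2 = t * (1 / max 1 √t) ^ 2 := by
      rw [div_pow, Real.sq_sqrt ht0]; ring
    rw [this]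
    simp only [f]
    ring
  rw [h1, Real.norm_of_nonneg (by positivity)]
  refine pow_le_one₀ (by positivity) ?_
  rw [div_le_one (by positivity)]
  exact le_max_right _ _

theorem cfcₙ_rpow_eq_nnrpow {a : A} (ha : 0 ≤ a) {y : ℝ} (hy : 0 ≤ y) :
    cfcₙ (fun t : ℝ => t ^ y) a = a ^ y.toNNReal := by
  rw [CFC.nnrpow_eq_cfcₙ_real a y.toNNReal ha, Real.coe_toNNReal y hy]

/-- The map `x ↦ ‖∑ (x_k x_k^*)^{q/2}‖` is monotone in the elements `x_k x_k^*` for `q ≤ 2`. -/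
theorem norm_sum_rpow_le_of_le {ι : Type*} [Fintype ι] {q : ℝ} (hq : 0 < q) (hq2 : q ≤ 2)
    {a b : ι → A} (ha : ∀ k, 0 ≤ a k) (hab : ∀ k, a k ≤ b k) :
    ‖∑ k, cfcₙ (fun t : ℝ => t ^ (q / 2)) (a k)‖ ≤
      ‖∑ k, cfcₙ (fun t : ℝ => t ^ (q / 2)) (b k)‖ := by
  have hy : 0 ≤ q / 2 := by positivity
  simp only [cfcₙ_rpow_eq_nnrpow (ha _) hy, cfcₙ_rpow_eq_nnrpow ((ha _).trans (hab _)) hy]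
  refine CStarAlgebra.norm_le_norm_of_nonneg_of_le
    (Finset.sum_nonneg fun k _ => CFC.nnrpow_nonneg) (Finset.sum_le_sum fun k _ => ?_)
  -- Löwner–Heinz: powers with exponent in `[0, 1]` are operator monotone. This is where `q ≤ 2` is
  -- needed.
  exact CFC.nnrpow_le_nnrpow ⟨zero_le, by
    rw [Real.toNNReal_le_one]; linarith⟩ (hab k)

/-- Tuples in the `q`-ball of a quotient lift to tuples in the `q`-ball. -/
theorem exists_lift_ball {ι : Type*} [Fintype ι] (ρ : A →⋆ₙₐ[ℂ] D) (hρ : Function.Surjective ρ)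
    {q : ℝ} (hq : 0 < q) (hq2 : q ≤ 2) (x : ι → D)
    (hx : ‖∑ k, cfcₙ (fun t : ℝ => t ^ (q / 2)) (x k * star (x k))‖ ≤ 1) :
    ∃ X : ι → A, (∀ k, ρ (X k) = x k) ∧
      ‖∑ k, cfcₙ (fun t : ℝ => t ^ (q / 2)) (X k * star (X k))‖ ≤ 1 := by
  let _ : PartialOrder D := CStarAlgebra.spectralOrder D
  have : StarOrderedRing D := CStarAlgebra.spectralOrderedRing D
  have hy : 0 < q / 2 := by positivity
  have hcont : ∀ y : ℝ, 0 < y → Continuous (fun t : ℝ => t ^ y) := fun y hy =>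
    Real.continuous_rpow_const hy.le
  choose Y hY using fun k => hρ (x k)
  have hYx : ∀ k, ρ (cfcₙ (fun t : ℝ => t ^ (q / 2)) (Y k * star (Y k))) =
      cfcₙ (fun t : ℝ => t ^ (q / 2)) (x k * star (x k)) := fun k => by
    rw [ρ.map_real_cfcₙ (hcont _ hy) (Real.zero_rpow hy.ne') (IsSelfAdjoint.mul_star_self _),
      map_mul, map_star, hY]
  obtain ⟨a, ha0, hρa, ha1⟩ := exists_lift_nonneg_norm_sum_le_one ρ
    (fun k => cfcₙ (fun t : ℝ => t ^ (q / 2)) (Y k * star (Y k)))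
    (fun k => cfcₙ_nonneg fun t ht => Real.rpow_nonneg
      (quasispectrum_nonneg_of_nonneg _ (mul_star_self_nonneg _) t ht) _)
    (by simpa only [hYx] using hx)
  have hy' : 0 < (q / 2)⁻¹ := by positivity
  have hbq : ∀ k, cfcₙ (fun t : ℝ => t ^ (q / 2)) (cfcₙ (fun t : ℝ => t ^ (q / 2)⁻¹) (a k)) =
      a k := fun k => by
    have h0 : 0 ≤ cfcₙ (fun t : ℝ => t ^ (q / 2)⁻¹) (a k) := cfcₙ_nonneg fun t ht =>
      Real.rpow_nonneg (quasispectrum_nonneg_of_nonneg _ (ha0 k) t ht) _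
    rw [cfcₙ_rpow_eq_nnrpow h0 hy.le, cfcₙ_rpow_eq_nnrpow (ha0 k) hy'.le, Real.toNNReal_inv]
    exact CFC.nnrpow_inv_nnrpow (a k) 
      (Real.toNNReal_pos.2 hy).ne' (ha0 k)
  have hρb : ∀ k, ρ (cfcₙ (fun t : ℝ => t ^ (q / 2)⁻¹) (a k)) = x k * star (x k) := fun k => by
    have h0 := mul_star_self_nonneg (x k)
    have h1 : 0 ≤ cfcₙ (fun t : ℝ => t ^ (q / 2)) (x k * star (x k)) := cfcₙ_nonneg fun t ht =>
      Real.rpow_nonneg (quasispectrum_nonneg_of_nonneg _ h0 t ht) _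
    rw [ρ.map_real_cfcₙ (hcont _ hy') (Real.zero_rpow hy'.ne') (.of_nonneg (ha0 k)), hρa, hYx,
      cfcₙ_rpow_eq_nnrpow h1 hy'.le, cfcₙ_rpow_eq_nnrpow h0 hy.le, Real.toNNReal_inv]
    exact CFC.nnrpow_nnrpow_inv (x k * star (x k)) 
      (Real.toNNReal_pos.2 hy).ne' h0
  choose X hX hXb using fun k => exists_lift_mul_star_le ρ hρ
    (cfcₙ_nonneg (fun t ht => Real.rpow_nonneg
      (quasispectrum_nonneg_of_nonneg _ (ha0 k) t ht) _) :
      0 ≤ cfcₙ (fun t : ℝ => t ^ (q / 2)⁻¹) (a k)) (hρb k)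
  refine ⟨X, hX, ?_⟩
  refine (norm_sum_rpow_le_of_le hq hq2 (fun k => mul_star_self_nonneg (X k)) hXb).trans ?_
  simpa only [hbq] using ha1

end BallLifting

/-! ### Homogeneous polynomials under asymptotically central factors. -/

section Polynomials

open Filter Topology

theorem NCStarPoly.eval_eq_sum {s : ℕ} (p : NCStarPoly s) {A : Type v}
    [NonUnitalCStarAlgebra A] (x : Fin s → A) :
    p.eval x = p.coeff.sum fun m c =>
      c • FreeSemigroup.lift (Sum.elim x (fun k => star (x k))) m := by
  rw [NCStarPoly.eval, MonoidAlgebra.liftMagma_apply_apply]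
  rfl

theorem NCStarPoly.continuous_eval {s : ℕ} (p : NCStarPoly s) {A : Type v}
    [NonUnitalCStarAlgebra A] : Continuous (fun x : Fin s → A => p.eval x) := by
  have hword : ∀ m : FreeSemigroup (Fin s ⊕ Fin s), Continuous fun x : Fin s → A =>
      FreeSemigroup.lift (Sum.elim x (fun k => star (x k))) m := fun m => by
    have hletter : ∀ l : Fin s ⊕ Fin s, Continuous fun x : Fin s → A =>
        FreeSemigroup.lift (Sum.elim x (fun k => star (x k))) (FreeSemigroup.of l) := by
      rintro (k | k)
      · simpa using continuous_apply k
      · simpa using (continuous_apply k).star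
    induction m using FreeSemigroup.recOnMul with
    | ih1 l => exact hletter l
    | ih2 l m _ hm =>
      simp only [map_mul]
      exact (hletter l).mul hm
  simp only [NCStarPoly.eval_eq_sum]
  exact continuous_finsetSum _ fun m _ => (hword m).const_smul _

theorem wordDegree_of {s r : ℕ} (l : Fin s ⊕ Fin s) :
    wordDegree r (FreeSemigroup.of l) = if (Sum.elim id id l : Fin s).val < r then 1 else 0 := by
  simp [wordDegree, FreeSemigroup.of, List.countP_cons]

theorem wordDegree_mul {s r : ℕ} (m n : FreeSemigroup (Fin s ⊕ Fin s)) :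
    wordDegree r (m * n) = wordDegree r m + wordDegree r n := by
  simp only [wordDegree, FreeSemigroup.head_mul, FreeSemigroup.tail_mul, ← List.cons_append,
    List.countP_append]

variable {ι : Type*} {l : Filter ι}

theorem tendsto_zero_mul_of_norm_le {R : Type*} [NonUnitalSeminormedRing R] {f g : ι → R}
    {M : ℝ} (hf : Tendsto f l (𝓝 0)) (hg : ∀ i, ‖g i‖ ≤ M) :
    Tendsto (fun i => f i * g i) l (𝓝 0) := by
  refine squeeze_zero_norm (a := fun i => ‖f i‖ * M) (fun i => ?_)
    (by simpa using hf.norm.mul_const M)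
  exact (norm_mul_le _ _).trans (mul_le_mul_of_nonneg_left (hg i) (norm_nonneg _))

theorem tendsto_mul_zero_of_norm_le {R : Type*} [NonUnitalSeminormedRing R] {f g : ι → R}
    {M : ℝ} (hf : ∀ i, ‖f i‖ ≤ M) (hg : Tendsto g l (𝓝 0)) :
    Tendsto (fun i => f i * g i) l (𝓝 0) := by
  refine squeeze_zero_norm (a := fun i => M * ‖g i‖) (fun i => ?_)
    (by simpa using hg.norm.const_mul M)
  exact (norm_mul_le _ _).trans (mul_le_mul_of_nonneg_right (hf i) (norm_nonneg _))

theorem norm_pow_le_one' {R : Type*} [SeminormedRing R] [NormOneClass R] {a : R} (h : ‖a‖ ≤ 1)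
    (n : ℕ) : ‖a ^ n‖ ≤ 1 :=
  (norm_pow_le a n).trans (pow_le_one₀ (norm_nonneg _) h)

theorem tendsto_commutator_pow {R : Type*} [SeminormedRing R] [NormOneClass R] {h : ι → R}
    (hh : ∀ i, ‖h i‖ ≤ 1) {y : R} (hy : Tendsto (fun i => h i * y - y * h i) l (𝓝 0)) (n : ℕ) :
    Tendsto (fun i => h i ^ n * y - y * h i ^ n) l (𝓝 0) := by
  induction n with
  | zero => simp [tendsto_const_nhds]
  | succ n ih =>
    have := (tendsto_mul_zero_of_norm_le (fun i => norm_pow_le_one' (hh i) n) hy).add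
      (tendsto_zero_mul_of_norm_le ih hh)
    rw [add_zero] at this
    refine this.congr fun i => ?_
    rw [pow_succ]
    noncomm_ring

/-- If asymptotically central contractions `h i` are inserted into the letters of a word, then
they can asymptotically be moved to the right. -/
theorem tendsto_lift_sub_lift_mul_pow {R α : Type*} [NormedRing R] [NormOneClass R]
    {h : ι → R} (hh : ∀ i, ‖h i‖ ≤ 1) {c : α → R} {c' : ι → α → R} {deg : FreeSemigroup α → ℕ}
    (hdeg : ∀ m n, deg (m * n) = deg m + deg n)
    (hc : ∀ a, Tendsto (fun i => h i * c a - c a * h i) l (𝓝 0))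
    (hc' : ∀ a, Tendsto (fun i => c' i a - c a * h i ^ deg (.of a)) l (𝓝 0))
    (m : FreeSemigroup α) :
    Tendsto (fun i => h i * FreeSemigroup.lift c m - FreeSemigroup.lift c m * h i) l (𝓝 0) ∧
      Tendsto (fun i => FreeSemigroup.lift (c' i) m - FreeSemigroup.lift c m * h i ^ deg m) l
        (𝓝 0) := by
  induction m using FreeSemigroup.recOnMul with
  | ih1 a => exact ⟨by simpa using hc a, by simpa using hc' a⟩
  | ih2 a m iha ihm =>
    obtain ⟨ha1, ha2⟩ := iha
    obtain ⟨hm1, hm2⟩ := ihm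
    simp only [map_mul, hdeg]
    set x := FreeSemigroup.lift c (FreeSemigroup.of a)
    set y := FreeSemigroup.lift c m
    have hpow := fun n => fun i => norm_pow_le_one' (hh i) n
    refine ⟨?_, ?_⟩
    · have := (ha1.mul_const y).add (hm1.const_mul x)
      simp only [zero_mul, mul_zero, add_zero] at this
      refine this.congr fun i => ?_
      noncomm_ring
    -- Telescoping into four null terms; including the product of the two errors avoids any bound on
    -- the words in `c' i`.
    · have h1 := ha2.mul hm2
      have h2 := tendsto_zero_mul_of_norm_le (ha2.mul_const y |>.trans (by simp)) (hpow (deg m))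
      have h3 := (tendsto_zero_mul_of_norm_le
        (tendsto_commutator_pow hh hm1 (deg (FreeSemigroup.of a))) (hpow (deg m))).const_mul x
      have h4 := (tendsto_mul_zero_of_norm_le (hpow (deg (FreeSemigroup.of a))) hm2).const_mul x
      have := ((h1.add h2).add h3).add h4
      simp only [mul_zero, add_zero] at this
      refine this.congr fun i => ?_
      rw [pow_add]
      noncomm_ring

/-- Multiplying the first `r` variables by asymptotically central contractions multiplies the
value of a `d`-homogeneous polynomial asymptotically by their `d`-th power. -/
theorem NCStarPoly.tendsto_eval_sub_eval_mul_pow {s r d : ℕ} {p : NCStarPoly s}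
    (hp : p.IsHomogeneousInFirst r d) {R : Type v} [CStarAlgebra R] [NormOneClass R] {h : ι → R}
    (hh : ∀ i, ‖h i‖ ≤ 1) (hhs : ∀ i, IsSelfAdjoint (h i)) (x : Fin s → R)
    (hx : ∀ k, Tendsto (fun i => h i * x k - x k * h i) l (𝓝 0)) :
    Tendsto (fun i => p.eval (fun k => if k.val < r then x k * h i else x k) -
      p.eval x * h i ^ d) l (𝓝 0) := by
  -- The adjoint of `x k * h i` has `h i` on the left, so it must also be moved past `star (x k)`.
  have hstar : ∀ k, Tendsto (fun i => h i * star (x k) - star (x k) * h i) l (𝓝 0) := fun k => by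
    have := (hx k).star.neg
    rw [star_zero, neg_zero] at this
    refine this.congr fun i => ?_
    simp [(hhs i).star_eq]
  have hword := fun m => (tendsto_lift_sub_lift_mul_pow (l := l) hh
    (c := Sum.elim x (fun k => star (x k)))
    (c' := fun i => Sum.elim (fun k => if k.val < r then x k * h i else x k)
      (fun k => star (if k.val < r then x k * h i else x k)))
    (deg := wordDegree r) wordDegree_mul
    (by rintro (k | k); exacts [hx k, hstar k])
    (by
      rintro (k | k)
      · by_cases hk : k.val < r <;> simp [wordDegree_of, hk, tendsto_const_nhds]
      · by_cases hk : k.val < r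
        · simpa [wordDegree_of, hk, (hhs _).star_eq] using hstar k
        · simp [wordDegree_of, hk, tendsto_const_nhds]) m).2
  have hsum := tendsto_finsetSum p.coeff.support fun m _ => (hword m).const_smul (p.coeff m)
  simp only [smul_zero, Finset.sum_const_zero] at hsum
  refine hsum.congr fun i => ?_
  rw [NCStarPoly.eval_eq_sum, NCStarPoly.eval_eq_sum, Finsupp.sum, Finsupp.sum, Finset.sum_mul,
    ← Finset.sum_sub_distrib]
  refine Finset.sum_congr rfl fun m hm => ?_
  rw [hp m hm, smul_sub, smul_mul_assoc]

end Polynomials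

/-! ### Reducing a norm by a factor `1 - δe`. -/

section NormReduction

/-- Write `h = 1 - δe`. Then `hmh ≤ C²h² ≤ C²((1-e) + (1-δ)²e)`, whereas `hgh` is close to `(1-δ)²
ege ≤ (1-δ)²‖g‖e` because `ge` is close to `g`. By `hgC` the coefficients of `e` add up to at most
`C²`, and the total is at most `C²` plus the error. No commutation of `e` with `y*y` is needed. -/
theorem norm_sq_mul_one_sub_smul_le {U : Type v} [CStarAlgebra U] [PartialOrder U]
    [StarOrderedRing U] {y m g e : U} {C δ : ℝ} (hδ0 : 0 ≤ δ) (hδ1 : δ ≤ 1)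
    (hy : star y * y = m + g) (hm : m ≤ (C ^ 2) • (1 : U)) (hg : IsSelfAdjoint g)
    (hgC : (1 - δ) ^ 2 * ‖g‖ ≤ C ^ 2 - (1 - δ) ^ 2 * C ^ 2) (he0 : 0 ≤ e) (he1 : e ≤ 1) :
    ‖y * (1 - δ • e)‖ ^ 2 ≤ C ^ 2 + 6 * ‖g - g * e‖ := by
  have hes : IsSelfAdjoint e := .of_nonneg he0
  set h : U := 1 - δ • e with hh
  have hhs : IsSelfAdjoint h := (IsSelfAdjoint.one U).sub ((IsSelfAdjoint.all δ).smul hes)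
  have hee : e * e ≤ e := by
    have h1 : 0 ≤ e * (1 - e) := by
      have hc : Commute e (1 - e) := (Commute.one_right e).sub_right (Commute.refl e)
      exact hc.mul_nonneg he0 (sub_nonneg.2 he1)
    rw [mul_sub, mul_one] at h1
    exact sub_nonneg.1 h1
  have hne : ‖e‖ ≤ 1 := (CStarAlgebra.norm_le_one_iff_of_nonneg e he0).2 he1
  set z := g - g * e with hz
  have hzs : star z = g - e * g := by rw [hz, star_sub, star_mul, hg.star_eq, hes.star_eq]
  set E := h * g * h - (1 - δ) ^ 2 • (e * g * e) with hE
  have hEs : IsSelfAdjoint E := by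
    have h1 : IsSelfAdjoint (h * g * h) := hg.conjugate_self hhs
    have h2 : IsSelfAdjoint (e * g * e) := hg.conjugate_self hes
    exact h1.sub ((IsSelfAdjoint.all ((1 - δ) ^ 2)).smul h2)
  -- Here `star z + e * z` equals `g - ege`, so every summand is controlled by `‖z‖`.
  have hEz : E = (1 - δ) ^ 2 • (star z + e * z) + δ • (z + star z) -
      δ ^ 2 • (star z + e * z) := by
    rw [hE, hzs, hz, hh]
    simp only [mul_sub, sub_mul, one_mul, mul_one, smul_mul_assoc, mul_smul_comm, mul_assoc]
    module
  have hez : ‖star z + e * z‖ ≤ 2 * ‖z‖ := by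
    have h1 := norm_add_le (star z) (e * z)
    have h2 := norm_mul_le e z
    rw [norm_star] at h1
    nlinarith [norm_nonneg z]
  have hEn : ‖E‖ ≤ 6 * ‖z‖ := by
    have h1 : ‖(1 - δ) ^ 2 • (star z + e * z)‖ ≤ 2 * ‖z‖ := by
      rw [norm_smul, Real.norm_of_nonneg (by positivity)]
      have := pow_le_one₀ (n := 2) (sub_nonneg.2 hδ1) (by linarith)
      nlinarith [norm_nonneg (star z + e * z)]
    have h2 : ‖δ ^ 2 • (star z + e * z)‖ ≤ 2 * ‖z‖ := by
      rw [norm_smul, Real.norm_of_nonneg (by positivity)]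
      have := pow_le_one₀ (n := 2) hδ0 hδ1
      nlinarith [norm_nonneg (star z + e * z)]
    have h3 : ‖δ • (z + star z)‖ ≤ 2 * ‖z‖ := by
      rw [norm_smul, Real.norm_of_nonneg hδ0]
      have := norm_add_le z (star z)
      rw [norm_star] at this
      nlinarith [norm_nonneg (z + star z)]
    rw [hEz]
    linarith [norm_sub_le ((1 - δ) ^ 2 • (star z + e * z) + δ • (z + star z))
      (δ ^ 2 • (star z + e * z)), norm_add_le ((1 - δ) ^ 2 • (star z + e * z)) (δ • (z + star z))]
  have hEle : E ≤ (6 * ‖z‖) • (1 : U) := by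
    refine hEs.le_algebraMap_norm_self.trans ?_
    rw [Algebra.algebraMap_eq_smul_one]
    exact smul_le_smul_of_nonneg_right hEn zero_le_one
  have hge : e * g * e ≤ ‖g‖ • e := by
    have h1 : e * g * star e ≤ ‖g‖ • (e * star e) :=
      CStarAlgebra.star_right_conjugate_le_norm_smul hg
    rw [hes.star_eq] at h1
    exact h1.trans (smul_le_smul_of_nonneg_left hee (norm_nonneg g))
  have hhh : h * h ≤ (1 - e) + (1 - δ) ^ 2 • e := by
    have h1 : (1 - e) + (1 - δ) ^ 2 • e - h * h = δ ^ 2 • (e - e * e) := by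
      rw [hh]
      simp only [mul_sub, sub_mul, one_mul, mul_one, smul_mul_assoc, mul_smul_comm]
      module
    rw [← sub_nonneg, h1]
    exact smul_nonneg (by positivity) (sub_nonneg.2 hee)
  have hmain : star (y * h) * (y * h) ≤ (C ^ 2 + 6 * ‖z‖) • (1 : U) := by
    have h1 : star (y * h) * (y * h) = h * m * h + ((1 - δ) ^ 2 • (e * g * e) + E) := by
      rw [hE, add_sub_cancel, star_mul, hhs.star_eq, ← add_mul, ← mul_add, ← hy]
      simp only [mul_assoc]
    have h2 : h * m * h ≤ C ^ 2 • (h * h) := by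
      have := star_right_conjugate_le_conjugate hm h
      rw [hhs.star_eq] at this
      simpa only [mul_smul_comm, smul_mul_assoc, mul_one] using this
    have h3 : C ^ 2 • (h * h) ≤ C ^ 2 • ((1 - e) + (1 - δ) ^ 2 • e) :=
      smul_le_smul_of_nonneg_left hhh (by positivity)
    have h4 : (1 - δ) ^ 2 • (e * g * e) ≤ (C ^ 2 - (1 - δ) ^ 2 * C ^ 2) • e := by
      refine (smul_le_smul_of_nonneg_left hge (by positivity)).trans ?_
      rw [smul_smul]
      exact smul_le_smul_of_nonneg_right hgC he0
    rw [h1]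
    refine (add_le_add (h2.trans h3) (add_le_add h4 hEle)).trans (le_of_eq ?_)
    module
  have h5 := (CStarAlgebra.norm_le_iff_le_algebraMap (star (y * h) * (y * h))
    (r := C ^ 2 + 6 * ‖z‖) (by positivity) (star_mul_self_nonneg _)).2
    (by rw [Algebra.algebraMap_eq_smul_one]; exact hmain)
  rwa [CStarRing.norm_star_mul_self, ← pow_two] at h5

variable {A : Type v} {D : Type w} [NonUnitalCStarAlgebra A] [NonUnitalCStarAlgebra D]

/-- The part of `y^* y` above `C ^ 2`. -/
noncomputable def excess (C : ℝ) (y : A) : A := cfcₙ (fun t => max (t - C ^ 2) 0) (star y * y)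

/-- The spectrum of `ρ(y*y)` lies below `C²`, where the function defining the excess is zero. -/
theorem map_excess_eq_zero (ρ : A →⋆ₙₐ[ℂ] D) {C : ℝ} {y : A} (h : ‖ρ y‖ ≤ C) :
    ρ (excess C y) = 0 := by
  have hC : 0 ≤ C := (norm_nonneg _).trans h
  have hs : IsSelfAdjoint (star y * y) := .star_mul_self y
  rw [excess, ρ.map_real_cfcₙ (by fun_prop) (by simp [sq_nonneg]) hs,
    ← cfcₙ_const_zero ℝ (ρ (star y * y))]
  refine cfcₙ_congr fun t ht => max_eq_right ?_
  have h1 := norm_apply_le_norm_cfcₙ (fun t : ℝ => t) (ρ (star y * y)) ht (by fun_prop) rfl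
    (hs.map ρ)
  rw [cfcₙ_id' ℝ _ (hs.map ρ), map_mul, map_star, CStarRing.norm_star_mul_self] at h1
  have h2 : t ≤ ‖ρ y‖ * ‖ρ y‖ := (le_abs_self t).trans h1
  nlinarith [norm_nonneg (ρ y)]

/-- Split `y*y` as `min(·, C²)` plus the excess. The excess has norm at most `max(‖y‖² - C², 0)`, so
`(1-δ)‖y‖ ≤ C` supplies the numerical condition. -/
theorem norm_sq_inr_mul_one_sub_smul_le [PartialOrder A] [StarOrderedRing A] {y e : A} {C δ : ℝ}
    (hδ0 : 0 ≤ δ) (hδ1 : δ ≤ 1) (hy : (1 - δ) * ‖y‖ ≤ C) (he0 : 0 ≤ e)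
    (he1 : ‖e‖ ≤ 1) :
    ‖(y : Unitization ℂ A) * (1 - δ • (e : Unitization ℂ A))‖ ^ 2 ≤
      C ^ 2 + 6 * ‖excess C y - excess C y * e‖ := by
  have hz0 : 0 ≤ star y * y := star_mul_self_nonneg y
  have hzs : IsSelfAdjoint (star y * y) := .of_nonneg hz0
  have hgs : IsSelfAdjoint (excess C y) := IsSelfAdjoint.cfcₙ
  set m := cfcₙ (fun t => min t (C ^ 2)) (star y * y) with hm
  have hms : IsSelfAdjoint m := IsSelfAdjoint.cfcₙ
  have hmg : star y * y = m + excess C y := by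
    rw [hm, excess, ← cfcₙ_add (fun t => min t (C ^ 2)) (fun t => max (t - C ^ 2) 0)
      (star y * y) (by fun_prop) (min_eq_left (sq_nonneg C)) (by fun_prop)
      (max_eq_right (by nlinarith [sq_nonneg C]))]
    nth_rewrite 1 [← cfcₙ_id' ℝ (star y * y)]
    congr 1
    ext t
    rcases le_total t (C ^ 2) with h | h
    · rw [min_eq_left h, max_eq_right (by linarith), add_zero]
    · rw [min_eq_right h, max_eq_left (by linarith)]; ring
  have hmn : ‖m‖ ≤ C ^ 2 := norm_cfcₙ_le fun t ht => by
    have ht0 := quasispectrum_nonneg_of_nonneg _ hz0 t ht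
    rw [Real.norm_of_nonneg (by positivity)]
    exact min_le_right _ _
  have hgn : ‖excess C y‖ ≤ max (‖y‖ ^ 2 - C ^ 2) 0 := norm_cfcₙ_le fun t ht => by
    have h1 := norm_apply_le_norm_cfcₙ (fun t : ℝ => t) (star y * y) ht
      (by fun_prop) rfl hzs
    rw [cfcₙ_id' ℝ _ hzs, CStarRing.norm_star_mul_self, ← pow_two] at h1
    rw [Real.norm_of_nonneg (le_max_right _ _)]
    exact max_le_max_right _ (by linarith [le_abs_self t, show |t| ≤ ‖y‖ ^ 2 from h1])
  have := norm_sq_mul_one_sub_smul_le (U := Unitization ℂ A) (y := (y : Unitization ℂ A))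
    (m := (m : Unitization ℂ A)) (g := ((excess C y : A) : Unitization ℂ A))
    (e := (e : Unitization ℂ A)) (C := C) hδ0 hδ1
    (by rw [← Unitization.inr_star, ← Unitization.inr_mul, hmg, Unitization.inr_add])
    (by
      refine (hms.inr ℂ).le_algebraMap_norm_self.trans ?_
      rw [Algebra.algebraMap_eq_smul_one, Unitization.norm_inr]
      exact smul_le_smul_of_nonneg_right hmn zero_le_one)
    (hgs.inr ℂ)
    (by
      rw [Unitization.norm_inr]
      refine (mul_le_mul_of_nonneg_left hgn (by positivity)).trans ?_
      rcases le_total (‖y‖ ^ 2 - C ^ 2) 0 with h | h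
      · rw [max_eq_right h]
        nlinarith [mul_nonneg hδ0 (sq_nonneg C), mul_nonneg (mul_nonneg hδ0 (sub_nonneg.2 hδ1)) (sq_nonneg C)]
      · rw [max_eq_left h]
        have : ((1 - δ) * ‖y‖) ^ 2 ≤ C ^ 2 :=
          pow_le_pow_left₀ (mul_nonneg (by linarith) (norm_nonneg y)) hy 2
        nlinarith)
    (Unitization.inr_nonneg_iff.2 he0)
    ((CStarAlgebra.norm_le_one_iff_of_nonneg _ (Unitization.inr_nonneg_iff.2 he0)).1
      (by rwa [Unitization.norm_inr]))
  rwa [← Unitization.inr_mul, ← Unitization.inr_sub, Unitization.norm_inr] at this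

end NormReduction

/-! ### Lifting the polynomial bounds by successive improvement. -/

section PolynomialLifting

open Filter Topology

variable {A : Type v} {D : Type w} [NonUnitalCStarAlgebra A] [NonUnitalCStarAlgebra D]

/-- Kernels of *-homomorphisms have sequential quasi-central approximate units, relative to
finitely many elements. -/
theorem exists_seq_quasicentral_approximate_unit [PartialOrder A] [StarOrderedRing A]
    (ρ : A →⋆ₙₐ[ℂ] D) {ι κ : Type*} [Fintype ι] [Fintype κ] (x : ι → A) (g : κ → A)
    (hg : ∀ j, ρ (g j) = 0) :
    ∃ e : ℕ → A, (∀ n, ρ (e n) = 0) ∧ (∀ n, 0 ≤ e n) ∧ (∀ n, ‖e n‖ ≤ 1) ∧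
      (∀ j, Tendsto (fun n => g j - g j * e n) atTop (𝓝 0)) ∧
      ∀ k, Tendsto (fun n => e n * x k - x k * e n) atTop (𝓝 0) := by
  classical
  have hε : ∀ n : ℕ, (0 : ℝ) < 1 / ((n : ℝ) + 1) := fun n => by positivity
  choose e h1 h2 h3 h4 h5 using fun n => exists_quasicentral_approximate_unit ρ
    (Finset.univ.image x) (Finset.univ.image g) (by simpa using hg) (hε n)
  refine ⟨e, h1, h2, h3, fun j => ?_, fun k => ?_⟩
  · exact squeeze_zero_norm (fun n => h4 n _ (Finset.mem_image_of_mem g (Finset.mem_univ j)))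
      tendsto_one_div_add_atTop_nhds_zero_nat
  · exact squeeze_zero_norm (fun n => h5 n _ (Finset.mem_image_of_mem x (Finset.mem_univ k)))
      tendsto_one_div_add_atTop_nhds_zero_nat

/-- Improvement of a lift that satisfies polynomial norm bounds up to `ε`: a perturbation of order
`ε` satisfies them up to a given `ε'`. -/
theorem exists_lift_improvement [PartialOrder A] [StarOrderedRing A] (ρ : A →⋆ₙₐ[ℂ] D)
    {s r J : ℕ} {p : Fin J → NCStarPoly s} {d : Fin J → ℕ} (hd : ∀ j, 1 ≤ d j)
    (hp : ∀ j, (p j).IsHomogeneousInFirst r (d j)) {C : Fin J → ℝ} {c : ℝ} (hc : 0 < c)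
    (hcC : ∀ j, c ≤ C j) (X : Fin s → A) (hρX : ∀ j, ‖(p j).eval (fun k => ρ (X k))‖ ≤ C j)
    {ε ε' : ℝ} (hε : 0 < ε) (hε' : 0 < ε') (hX : ∀ j, ‖(p j).eval X‖ ≤ C j + ε) :
    ∃ X' : Fin s → A, (∀ k, ρ (X' k) = ρ (X k)) ∧
      (∀ k, X' k * star (X' k) ≤ X k * star (X k)) ∧ (∀ k, ‖X' k - X k‖ ≤ ε / c * ‖X k‖) ∧
      ∀ j, ‖(p j).eval X'‖ ≤ C j + ε' := by
  have hC : ∀ j, 0 < C j := fun j => hc.trans_le (hcC j)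
  -- Chosen so that `(1-δ)(C_j + ε) ≤ C_j` for every `C_j ≥ c`, with `δ` still of order `ε`.
  set δ : ℝ := ε / (c + ε) with hδ
  have hδ0 : 0 ≤ δ := by positivity
  have hδ1 : δ ≤ 1 := by rw [hδ, div_le_one (by positivity)]; linarith
  have hδc : δ ≤ ε / c := div_le_div_of_nonneg_left hε.le hc (by linarith)
  have hδC : ∀ j, (1 - δ) * ‖(p j).eval X‖ ≤ C j := fun j => by
    refine (mul_le_mul_of_nonneg_left (hX j) (by linarith)).trans ?_
    have : 1 - δ = c / (c + ε) := by rw [hδ]; field_simp; ring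
    rw [this, div_mul_eq_mul_div, div_le_iff₀ (by positivity)]
    nlinarith [hcC j]
  obtain ⟨e, he0, hep, hen, heg, hex⟩ := exists_seq_quasicentral_approximate_unit ρ X
    (fun j => excess (C j) ((p j).eval X))
    (fun j => map_excess_eq_zero ρ (by rw [NCStarPoly.map_eval]; exact hρX j))
  let U := Unitization ℂ A
  let h : ℕ → U := fun n => 1 - δ • (e n : U)
  have hep' : ∀ n, 0 ≤ (e n : U) := fun n => Unitization.inr_nonneg_iff.2 (hep n)
  have hs : ∀ n, IsSelfAdjoint (h n) := fun n =>
    (IsSelfAdjoint.one U).sub ((IsSelfAdjoint.all δ).smul (.of_nonneg (hep' n)))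
  have he1 : ∀ n, (e n : U) ≤ 1 := fun n =>
    (CStarAlgebra.norm_le_one_iff_of_nonneg _ (hep' n)).1 (by rw [Unitization.norm_inr]; exact hen n)
  have hh : ∀ n, ‖h n‖ ≤ 1 := fun n => by
    have h1 : δ • (e n : U) ≤ 1 := by
      refine (smul_le_smul_of_nonneg_left (he1 n) hδ0).trans ?_
      exact smul_le_of_le_one_left zero_le_one hδ1
    rw [CStarAlgebra.norm_le_one_iff_of_nonneg _ (sub_nonneg.2 h1)]
    exact sub_le_self _ (smul_nonneg hδ0 (hep' n))
  let X' : ℕ → Fin s → A := fun n k => if k.val < r then X k - δ • (X k * e n) else X k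
  have hinr : ∀ n k, (X' n k : U) = if k.val < r then (X k : U) * h n else X k := fun n k => by
    simp only [X', h]
    split_ifs
    · rw [Unitization.inr_sub, Unitization.inr_smul, Unitization.inr_mul, mul_sub, mul_one,
        mul_smul_comm]
    · rfl
  have hcomm : ∀ k, Tendsto (fun n => h n * (X k : U) - (X k : U) * h n) atTop (𝓝 0) := fun k => by
    have h1 : Tendsto (fun n => -(δ • ((e n * X k - X k * e n : A) : U))) atTop (𝓝 0) := by
      have := ((Unitization.isometry_inr (𝕜 := ℂ) (A := A)).continuous.tendsto 0).comp (hex k)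
      simpa using (this.const_smul δ).neg
    refine h1.congr fun n => ?_
    simp only [h, Unitization.inr_sub, Unitization.inr_mul, sub_mul, mul_sub, one_mul, mul_one,
      smul_mul_assoc, mul_smul_comm, smul_sub]
    abel
  have heval : ∀ (x : Fin s → A) j, (((p j).eval x : A) : U) = (p j).eval (fun k => (x k : U)) :=
    fun x j => NCStarPoly.map_eval (p j) (Unitization.inrNonUnitalStarAlgHom ℂ A) x
  have hev : ∀ j, ∀ᶠ n in atTop, ‖(p j).eval (X' n)‖ ≤ C j + ε' := fun j => by
    have h1 := NCStarPoly.tendsto_eval_sub_eval_mul_pow (l := atTop) (hp j) hh hs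
      (fun k => (X k : U)) hcomm
    simp only [← hinr, ← heval] at h1
    have h2 := (heg j).norm.const_mul 6
    rw [norm_zero, mul_zero] at h2
    have hη : 0 < (C j + ε' / 2) ^ 2 - C j ^ 2 := by nlinarith [hC j]
    filter_upwards [h1.norm.eventually_le_const (show ‖(0 : U)‖ < ε' / 2 by simpa using hε'),
      h2.eventually_le_const hη] with n hn1 hn2
    have h3 := norm_sq_inr_mul_one_sub_smul_le hδ0 hδ1 (hδC j) (hep n) (hen n)
    have h4 : ‖(((p j).eval X : A) : U) * h n‖ ≤ C j + ε' / 2 := by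
      refine abs_le_of_sq_le_sq' ?_ (by linarith [hC j]) |>.2
      exact h3.trans (by linarith)
    have h5 : ‖(((p j).eval X : A) : U) * h n ^ d j‖ ≤ C j + ε' / 2 := by
      obtain ⟨m, hm⟩ := Nat.exists_eq_add_of_le (hd j)
      rw [hm, pow_add, pow_one, ← mul_assoc]
      refine (norm_mul_le _ _).trans ((mul_le_of_le_one_right (norm_nonneg _) ?_).trans h4)
      exact norm_pow_le_one' (hh n) m
    rw [← Unitization.norm_inr (𝕜 := ℂ)]
    have h6 := norm_sub_norm_le (((p j).eval (X' n) : A) : U)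
      ((((p j).eval X : A) : U) * h n ^ d j)
    linarith
  obtain ⟨n, hn⟩ := (eventually_all.2 hev).exists
  refine ⟨X' n, fun k => ?_, fun k => ?_, fun k => ?_, hn⟩
  · simp only [X']
    split_ifs
    · have : δ • (X k * e n) = (δ : ℂ) • (X k * e n) := (Complex.coe_smul δ _).symm
      rw [this, map_sub, map_smul, map_mul, he0, mul_zero, smul_zero, sub_zero]
    · rfl
  · by_cases hk : k.val < r
    · rw [← Unitization.inr_le_iff _ _ (.mul_star_self _) (.mul_star_self _), Unitization.inr_mul,
        Unitization.inr_star, hinr, if_pos hk, star_mul, (hs n).star_eq, Unitization.inr_mul,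
        Unitization.inr_star]
      have h1 := CStarAlgebra.star_right_conjugate_le_norm_smul (a := (X k : U))
        (b := h n * h n) (by rw [← pow_two]; exact (hs n).pow 2)
      have h2 : ‖h n * h n‖ ≤ 1 :=
        (norm_mul_le _ _).trans (mul_le_one₀ (hh n) (norm_nonneg _) (hh n))
      have h3 := h1.trans (smul_le_of_le_one_left (mul_star_self_nonneg _) h2)
      simpa only [mul_assoc] using h3
    · simp only [X', if_neg hk, le_refl]
  · simp only [X']
    split_ifs
    · rw [sub_sub_cancel_left, norm_neg, norm_smul, Real.norm_of_nonneg hδ0]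
      refine mul_le_mul hδc ?_ (norm_nonneg _) (by positivity)
      exact (norm_mul_le _ _).trans (mul_le_of_le_one_right (norm_nonneg _) (hen n))
    · rw [sub_self, norm_zero]
      positivity

/-- Simultaneous norm-preserving lifting of homogeneous polynomials. -/
theorem exists_lift_eval_le [PartialOrder A] [StarOrderedRing A] (ρ : A →⋆ₙₐ[ℂ] D)
    {s r J : ℕ} {p : Fin J → NCStarPoly s} {d : Fin J → ℕ} (hd : ∀ j, 1 ≤ d j)
    (hp : ∀ j, (p j).IsHomogeneousInFirst r (d j)) {C : Fin J → ℝ} (hC : ∀ j, 0 < C j)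
    (X : Fin s → A) (hρX : ∀ j, ‖(p j).eval (fun k => ρ (X k))‖ ≤ C j) :
    ∃ X' : Fin s → A, (∀ k, ρ (X' k) = ρ (X k)) ∧
      (∀ k, X' k * star (X' k) ≤ X k * star (X k)) ∧ ∀ j, ‖(p j).eval X'‖ ≤ C j := by
  obtain ⟨c, hc, hcC⟩ : ∃ c : ℝ, 0 < c ∧ ∀ j, c ≤ C j := by
    -- A small positive number works for all `j` at once, including the case `J = 0`.
    have := eventually_all.2 fun j => eventually_le_nhds (hC j) |>.filter_mono
      (nhdsWithin_le_nhds (s := Set.Ioi 0))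
    obtain ⟨c, h1, h2⟩ := (this.and self_mem_nhdsWithin).exists
    exact ⟨c, h2, h1⟩
  set E : ℝ := 1 + ∑ j, ‖(p j).eval X‖ with hE
  have hE0 : 0 < E := by positivity
  let ε : ℕ → ℝ := fun n => E * (1 / 2) ^ n
  have hε : ∀ n, 0 < ε n := fun n => by positivity
  let P : ℕ → (Fin s → A) → Prop := fun n Y => (∀ k, ρ (Y k) = ρ (X k)) ∧
    (∀ k, Y k * star (Y k) ≤ X k * star (X k)) ∧ ∀ j, ‖(p j).eval Y‖ ≤ C j + ε n
  have h0 : P 0 X := ⟨fun _ => rfl, fun _ => le_rfl, fun j => by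
    have := Finset.single_le_sum (f := fun j => ‖(p j).eval X‖) (fun _ _ => norm_nonneg _)
      (Finset.mem_univ j)
    simp only [ε, pow_zero, mul_one, hE]
    linarith [hC j]⟩
  have hstep : ∀ n (Y : {Y // P n Y}), ∃ Z : {Z // P (n + 1) Z},
      ∀ k, ‖Z.1 k - Y.1 k‖ ≤ ε n / c * ‖X k‖ := fun n ⟨Y, hY1, hY2, hY3⟩ => by
    obtain ⟨Z, hZ1, hZ2, hZ3, hZ4⟩ := exists_lift_improvement ρ hd hp hc hcC Y
      (by simpa only [hY1] using hρX) (hε n) (hε (n + 1)) hY3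
    refine ⟨⟨Z, fun k => (hZ1 k).trans (hY1 k), fun k => (hZ2 k).trans (hY2 k), hZ4⟩,
      fun k => (hZ3 k).trans ?_⟩
    -- `YY* ≤ XX*` keeps `‖Y k‖ ≤ ‖X k‖` along the iteration, so the steps are bounded by one
    -- geometric series.
    exact mul_le_mul_of_nonneg_left (norm_le_norm_of_mul_star_le (hY2 k))
      (div_nonneg (hε n).le hc.le)
  choose next hnext using hstep
  let Y : ∀ n, {Y // P n Y} := fun n => Nat.rec ⟨X, h0⟩ next n
  have hlim : ∀ k, ∃ Z, Tendsto (fun n => (Y n).1 k) atTop (𝓝 Z) := fun k =>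
    cauchySeq_tendsto_of_complete <| cauchySeq_of_le_geometric (1 / 2) (E / c * ‖X k‖)
      (by norm_num) fun n => by
        rw [dist_comm, dist_eq_norm]
        refine (hnext n (Y n) k).trans (le_of_eq ?_)
        simp only [ε]
        ring
  choose Z hZ using hlim
  refine ⟨Z, fun k => ?_, fun k => ?_, fun j => ?_⟩
  · refine tendsto_nhds_unique ((ρ.continuous_of_cstar.tendsto _).comp (hZ k)) ?_
    simp only [Function.comp_def, (Y _).2.1 k, tendsto_const_nhds]
  · exact le_of_tendsto ((hZ k).mul (hZ k).star) (Eventually.of_forall fun n => (Y n).2.2.1 k)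
  · have h1 : Tendsto (fun n => ‖(p j).eval (Y n).1‖) atTop (𝓝 ‖(p j).eval Z‖) :=
      (((p j).continuous_eval.tendsto Z).comp (tendsto_pi_nhds.2 hZ)).norm
    have h2 : Tendsto (fun n => C j + ε n) atTop (𝓝 (C j)) := by
      simpa [ε] using ((tendsto_pow_atTop_nhds_zero_of_lt_one (r := (1 / 2 : ℝ)) (by norm_num)
        (by norm_num)).const_mul E).const_add (C j)
    exact le_of_tendsto_of_tendsto' h1 h2 fun n => (Y n).2.2.2 j

end PolynomialLifting

/-! ### From lifting relations to projectivity. -/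

section Projectivity

theorem SoftBallRelation.map {s J : ℕ} {q : ℝ} (hq : 0 < q) {p : Fin J → NCStarPoly s}
    {C : Fin J → ℝ} {A : Type v} {B : Type w} [NonUnitalCStarAlgebra A] [NonUnitalCStarAlgebra B]
    (φ : A →⋆ₙₐ[ℂ] B) {x : Fin s → A} (h : SoftBallRelation q p C A x) :
    SoftBallRelation q p C B (fun k => φ (x k)) := by
  refine ⟨?_, fun j => ?_⟩
  · have h1 : ∀ k, cfcₙ (fun t : ℝ => t ^ (q / 2)) (φ (x k) * star (φ (x k))) =
        φ (cfcₙ (fun t : ℝ => t ^ (q / 2)) (x k * star (x k))) := fun k => by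
      rw [φ.map_real_cfcₙ (Real.continuous_rpow_const (by positivity))
        (Real.zero_rpow (by positivity)) (.mul_star_self _), map_mul, map_star]
    simp only [h1, ← map_sum]
    exact (NonUnitalStarAlgHom.norm_apply_le φ _).trans h.1
  · rw [← NCStarPoly.map_eval]
    exact (NonUnitalStarAlgHom.norm_apply_le φ _).trans (h.2 j)

theorem SoftBallRelation.exists_lift {s r J : ℕ} {p : Fin J → NCStarPoly s} {d : Fin J → ℕ}
    (hd : ∀ j, 1 ≤ d j) (hp : ∀ j, (p j).IsHomogeneousInFirst r (d j)) {C : Fin J → ℝ}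
    (hC : ∀ j, 0 < C j) {q : ℝ} (hq0 : 0 < q) (hq2 : q ≤ 2) {B : Type v} {D : Type w}
    [NonUnitalCStarAlgebra B] [NonUnitalCStarAlgebra D] (ρ : B →⋆ₙₐ[ℂ] D)
    (hρ : Function.Surjective ρ) {x : Fin s → D} (hx : SoftBallRelation q p C D x) :
    ∃ X : Fin s → B, (∀ k, ρ (X k) = x k) ∧ SoftBallRelation q p C B X := by
  let _ : PartialOrder B := CStarAlgebra.spectralOrder B
  have : StarOrderedRing B := CStarAlgebra.spectralOrderedRing B
  obtain ⟨Y, hY, hY1⟩ := exists_lift_ball ρ hρ hq0 hq2 x hx.1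
  obtain ⟨X, hX, hXY, hXp⟩ := exists_lift_eval_le ρ hd hp hC Y
    (by simpa only [hY] using hx.2)
  exact ⟨X, fun k => (hX k).trans (hY k),
    (norm_sum_rpow_le_of_le hq0 hq2 (fun k => mul_star_self_nonneg (X k)) hXY).trans hY1, hXp⟩

end Projectivity

theorem theorem5p4 (s r J : ℕ) (hrs : r ≤ s) (p : Fin J → NCStarPoly s) (d : Fin J → ℕ)
    (hd : ∀ j, 1 ≤ d j) (hp : ∀ j, (p j).IsHomogeneousInFirst r (d j))
    (C : Fin J → ℝ) (hC : ∀ j, 0 < C j) (q : ℝ) (hq0 : 0 < q) (hq2 : q ≤ 2) :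
    IsProjectiveCStar.{u + 1, u} (UniversalCStar.{u} (SoftBallRelation.{u} q p C)) := by
  intro B D _ _ ρ hρ φ
  obtain ⟨x, hx, -, huniv⟩ := UniversalCStar.universal.{u} hq0 p C fun j => (hC j).le
  have hφx := hx.map hq0 φ
  obtain ⟨X, hX, hXrel⟩ := SoftBallRelation.exists_lift hd hp hC hq0 hq2 ρ hρ hφx
  obtain ⟨ψ, hψ, -⟩ := huniv B X hXrel
  -- `ρ ∘ ψ` and `φ` agree on the generators, hence everywhere by uniqueness.
  refine ⟨ψ, (huniv D _ hφx).unique (fun k => ?_) fun k => rfl⟩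
  rw [NonUnitalStarAlgHom.comp_apply, hψ, hX]
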